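/- Let $q=2^m$ for an integer $m\ge 0$, and let $n=q^2+q+1$. A complete $k$-coloring of a finite simple graph $G$ is a (not necessarily proper) assignment $\varsigma\colon V(G)\to\{1,\dots,k\}$ such that for every two different colors $i,j$ there is an edge $xy$ of $G$ with $\varsigma(x)=i$ and $\varsigma(y)=j$. The pseudoachromatic index $\psi'(G)$ is the largest $k$ for which the line graph $L(G)$ of $G$ has a complete $k$-coloring. Then the complete graph $K_n$ satisfies $$\psi'(K_n)\ \ge\ q^3+2q-3 .$$ -/

import Mathlib

/-- A complete `k`-coloring of a graph `G`: an assignment `c` of one of `k` colors to every vertex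
(not necessarily proper) such that every two different colors appear at the ends of some edge. -/
def IsCompleteColoring {V : Type*} (G : SimpleGraph V) (k : ℕ) (c : V → Fin k) : Prop :=
  ∀ i j : Fin k, i ≠ j → ∃ x y : V, G.Adj x y ∧ c x = i ∧ c y = j

/-- The pseudoachromatic number `ψ(G)` of a finite graph: the largest `k` for which `G` has a
complete `k`-coloring. The supremum is attained, see `pseudoachromaticNumber_isGreatest`. -/
noncomputable def pseudoachromaticNumber {V : Type*} (G : SimpleGraph V) : ℕ :=
  sSup {k : ℕ | ∃ c : V → Fin k, IsCompleteColoring G k c}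

/-- The pseudoachromatic index `ψ'(G)`: the pseudoachromatic number of the line graph of `G`. -/
noncomputable def pseudoachromaticIndex {V : Type*} (G : SimpleGraph V) : ℕ :=
  pseudoachromaticNumber G.lineGraph

/-- On a finite nonempty vertex set the maximum defining `ψ(G)` exists. -/
theorem pseudoachromaticNumber_isGreatest {V : Type*} [Finite V] [Nonempty V]
    (G : SimpleGraph V) :
    IsGreatest {k : ℕ | ∃ c : V → Fin k, IsCompleteColoring G k c}
      (pseudoachromaticNumber G) := by
  have hb : BddAbove {k : ℕ | ∃ c : V → Fin k, IsCompleteColoring G k c} := by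
    refine ⟨Nat.card V + 1, ?_⟩
    rintro k ⟨c, hc⟩
    by_cases hk : k ≤ 1
    · omega
    · have hs : Function.Surjective c := by
        intro i
        have : Nontrivial (Fin k) := Fin.nontrivial_iff_two_le.mpr (by omega)
        obtain ⟨j, hj⟩ := exists_ne i
        obtain ⟨x, y, -, hx, -⟩ := hc i j hj.symm
        exact ⟨x, hx⟩
      have h := Nat.card_le_card_of_surjective c hs
      rw [Nat.card_fin] at h
      omega
  have hne : {k : ℕ | ∃ c : V → Fin k, IsCompleteColoring G k c}.Nonempty :=
    ⟨1, fun _ => 0, fun i j hij => absurd (Subsingleton.elim i j) hij⟩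
  exact ⟨Nat.sSup_mem hne hb, fun k hk => le_csSup hb hk⟩

/-! Identify the vertices with the points of a projective plane of order `q`, and let each colour
class cover all points of some line; since lines meet, so do classes. Fix `q - 1` lines, no three
concurrent. On any other line, label the points by `F` with 0 used twice; edge sums give `q - 1`
nonzero covering classes and leave free the edge joining the two points labelled 0. On a fixed line,
sums mod `q + 1` give `q + 1` classes, a point `p` missing only the class `2p`. The free edge of
another line through `p`, placed to contain `p`, repairs this. Hall's theorem
(`exists_injective_line_through`) picks these lines injectively. In total there are `(q - 1)(q + 1)
+ (q² + 2)(q - 1)` colours. -/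

/-- Edge-disjoint colour classes `R c` on a vertex set of size `n`, any two of which share a vertex,
bound the pseudoachromatic index of `K_n` from below. -/
theorem card_le_pseudoachromaticIndex {V C : Type*} [Fintype V] [Fintype C] {n : ℕ}
    (hn : Fintype.card V = n) (R : C → V → V → Prop)
    (hsymm : ∀ c x y, R c x y → R c y x) (hne : ∀ c x y, R c x y → x ≠ y)
    (huniq : ∀ c c' x y, R c x y → R c' x y → c = c')
    (hmeet : ∀ c c', c ≠ c' → ∃ p x y, R c p x ∧ R c' p y) :
    Fintype.card C ≤ pseudoachromaticIndex (SimpleGraph.completeGraph (Fin n)) := by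
  classical
  rcases isEmpty_or_nonempty C with hC | ⟨⟨c₀⟩⟩
  · simp
  let e : V ≃ Fin n := Fintype.equivFinOfCardEq hn
  let σ : C ≃ Fin (Fintype.card C) := Fintype.equivFin C
  let E := (SimpleGraph.completeGraph (Fin n)).edgeSet
  let col : E → C := fun a =>
    if h : ∃ c x y, R c x y ∧ a.1 = s(e x, e y) then h.choose else c₀
  have hedge : ∀ c x y, R c x y → ∃ a : E, a.1 = s(e x, e y) ∧ col a = c := by
    intro c x y h
    have hxy : e x ≠ e y := fun h' => hne c x y h (e.injective h')
    refine ⟨⟨s(e x, e y), by simpa [E] using hxy⟩, rfl, ?_⟩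
    have hex : ∃ c' x' y', R c' x' y' ∧ s(e x, e y) = s(e x', e y') := ⟨c, x, y, h, rfl⟩
    simp only [col, dif_pos hex]
    obtain ⟨x', y', h', hs⟩ := hex.choose_spec
    rw [Sym2.eq_iff] at hs
    rcases hs with ⟨hx, hy⟩ | ⟨hx, hy⟩
    · rw [← e.injective hx, ← e.injective hy] at h'
      exact huniq _ _ _ _ h' h
    · rw [← e.injective hx, ← e.injective hy] at h'
      exact huniq _ _ _ _ (hsymm _ _ _ h') h
  have hbdd : BddAbove {k : ℕ | ∃ c : E → Fin k,
      IsCompleteColoring (SimpleGraph.completeGraph (Fin n)).lineGraph k c} := by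
    refine ⟨Nat.card E + 1, ?_⟩
    rintro k ⟨c, hc⟩
    by_cases hk : k ≤ 1
    · omega
    have hs : Function.Surjective c := fun i => by
      have : Nontrivial (Fin k) := Fin.nontrivial_iff_two_le.mpr (by omega)
      obtain ⟨j, hj⟩ := exists_ne i
      obtain ⟨x, y, -, hx, -⟩ := hc i j hj.symm
      exact ⟨x, hx⟩
    have h := Nat.card_le_card_of_surjective c hs
    rw [Nat.card_fin] at h
    omega
  refine le_csSup hbdd ⟨fun a => σ (col a), fun i j hij => ?_⟩
  obtain ⟨p, x, y, hx, hy⟩ := hmeet (σ.symm i) (σ.symm j) (σ.symm.injective.ne hij)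
  obtain ⟨a, ha, hca⟩ := hedge _ _ _ hx
  obtain ⟨b, hb, hcb⟩ := hedge _ _ _ hy
  refine ⟨a, b, ⟨?_, e p, ?_, ?_⟩, by simp [hca], by simp [hcb]⟩
  · rintro rfl
    exact hij (σ.symm.injective (hca.symm.trans hcb))
  · simp [ha]
  · simp [hb]

open Configuration in
/-- If `q - 1` lines of a projective plane of order `q` have no three concurrent, one can choose for
each incidence of a point with one of them another line through that point, injectively. -/
theorem exists_injective_line_through {P L ι : Type*} [Membership P L] [ProjectivePlane P L]
    [Fintype P] [Fintype L] [Fintype ι] (A : ι → L)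
    (hι : Fintype.card ι + 1 = ProjectivePlane.order P L)
    (harc : ∀ (p : P) (s : Finset ι), (∀ i ∈ s, p ∈ A i) → s.card ≤ 2) :
    ∃ f : (Σ i, {p : P // p ∈ A i}) → {l : L // l ∉ Set.range A},
      Function.Injective f ∧ ∀ x, (x.2 : P) ∈ (f x : L) := by
  classical
  have hq := ProjectivePlane.one_lt_order P L
  rw [← Fintype.all_card_le_filter_rel_iff_exists_injective
    (fun (x : Σ i, {p : P // p ∈ A i}) (l : {l : L // l ∉ Set.range A}) => (x.2 : P) ∈ (l : L))]
  intro S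
  -- Hall's condition by double counting: each flag has at least `(q + 1) - 2` candidate lines, and
  -- each candidate serves at most one flag per line `A i`, hence at most `q - 1`.
  refine Nat.le_of_mul_le_mul_right (c := Fintype.card ι) ?_ (by omega)
  refine Finset.card_mul_le_card_mul
    (fun (x : Σ i, {p : P // p ∈ A i}) (l : {l : L // l ∉ Set.range A}) => (x.2 : P) ∈ (l : L))
    (fun a ha => ?_) (fun b _ => ?_)
  · obtain ⟨i, p, hp⟩ := a
    have hcount : (Finset.univ.filter fun l : L => p ∈ l).card = Fintype.card ι + 2 := by
      have := ProjectivePlane.lineCount_eq (L := L) p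
      rw [lineCount, Nat.card_eq_fintype_card, Fintype.card_subtype] at this
      omega
    have hfull : ((Finset.univ.filter fun l : L => p ∈ l).filter (· ∈ Set.range A)).card ≤ 2 := by
      refine le_trans (Finset.card_le_card (t := (Finset.univ.filter fun i => p ∈ A i).image A) ?_)
        (Finset.card_image_le.trans (harc p _ (by simp)))
      intro l
      simp only [Finset.mem_filter, Finset.mem_univ, true_and, Finset.mem_image]
      rintro ⟨h, j, rfl⟩
      exact ⟨j, h, rfl⟩
    have hsplit := Finset.card_filter_add_card_filter_not
      (s := Finset.univ.filter fun l : L => p ∈ l) (· ∈ Set.range A)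
    have hle : ((Finset.univ.filter fun l : L => p ∈ l).filter (¬ · ∈ Set.range A)).card ≤
        (Finset.univ.filter fun l : {l : L // l ∉ Set.range A} => p ∈ (l : L)).card := by
      rw [← Finset.card_map (Function.Embedding.subtype _)]
      refine Finset.card_le_card fun l => ?_
      simp only [Finset.mem_filter, Finset.mem_univ, true_and, Finset.mem_map]
      rintro ⟨h, h'⟩
      exact ⟨⟨l, h'⟩, h, rfl⟩
    refine le_trans (by omega) (hle.trans (Finset.card_le_card fun l => ?_))
    simp only [Finset.mem_bipartiteAbove, Finset.mem_filter, Finset.mem_univ, true_and]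
    exact fun h => ⟨⟨_, ha, h⟩, h⟩
  · rw [← Finset.card_univ]
    refine Finset.card_le_card_of_injOn Sigma.fst (fun _ _ => Finset.mem_coe.2 (Finset.mem_univ _)) ?_
    rintro ⟨i, p, hp⟩ h ⟨j, p', hp'⟩ h' hij
    obtain rfl : i = j := hij
    simp only [Finset.coe_filter, Finset.bipartiteBelow, Set.mem_ofPred_eq] at h h'
    rcases Nondegenerate.eq_or_eq hp hp' h.2 h'.2 with rfl | h0
    · rfl
    · exact absurd ⟨i, h0⟩ b.2

open Configuration in
/-- A projective plane of order `q` containing `q - 1` lines, no three concurrent, and a group of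
exponent two and order `q` give a complete coloring of `L(K_{q²+q+1})` with `q³ + 2q - 3` colors. -/
theorem le_pseudoachromaticIndex_of_projectivePlane {P L F : Type*} [Membership P L]
    [ProjectivePlane P L] [Fintype P] [Fintype L] [AddCommGroup F] [Fintype F]
    (hF : ∀ x : F, x + x = 0) (hcard : Fintype.card F = ProjectivePlane.order P L)
    (A : {x : F // x ≠ 0} → L) (hA : Function.Injective A)
    (harc : ∀ (p : P) (s : Finset {x : F // x ≠ 0}), (∀ i ∈ s, p ∈ A i) → s.card ≤ 2) :
    Fintype.card F ^ 3 + 2 * Fintype.card F ≤ pseudoachromaticIndex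
      (SimpleGraph.completeGraph (Fin (Fintype.card F ^ 2 + Fintype.card F + 1))) + 3 := by
  classical
  set q := Fintype.card F with hq
  have hq1 : 1 < q := hcard ▸ ProjectivePlane.one_lt_order P L
  have hunits : Fintype.card {x : F // x ≠ 0} + 1 = q := by
    have := Fintype.card_subtype_compl (fun x : F => x = 0)
    rw [Fintype.card_subtype_eq] at this
    have h2 : Fintype.card {x : F // x ≠ 0} = q - 1 := by convert this
    omega
  have hpts (l : L) : Fintype.card {p : P // p ∈ l} = q + 1 := by
    rw [hcard, ← ProjectivePlane.pointCount_eq (P := P) l, pointCount, Nat.card_eq_fintype_card]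
  obtain ⟨f, hf, hfmem⟩ := exists_injective_line_through A (hunits.trans hcard) harc
  have e : ∀ l : L, {p : P // p ∈ l} ≃ ZMod (q + 1) := fun l =>
    Fintype.equivOfCardEq (by rw [hpts, ZMod.card])
  have hd : ∀ l : {l : L // l ∉ Set.range A}, ∃ d : {p : P // p ∈ l.1} ≃ Option F,
      ∀ x (h : f x = l), d ⟨x.2, h ▸ hfmem x⟩ = none := by
    intro l
    let d₀ : {p : P // p ∈ l.1} ≃ Option F :=
      Fintype.equivOfCardEq (by rw [hpts, Fintype.card_option])
    by_cases h : ∃ x, f x = l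
    · obtain ⟨x, rfl⟩ := h
      -- One relabelling suffices because `f` is injective: `l` repairs at most one flag.
      refine ⟨d₀.trans (Equiv.swap (d₀ ⟨x.2, hfmem x⟩) none), fun y hy => ?_⟩
      obtain rfl := hf hy
      simp
    · exact ⟨d₀, fun x hx => absurd ⟨x, hx⟩ h⟩
  choose d hd using hd
  -- `none` and `some 0` both get value 0; they are the ends of the free edge.
  let v : Option F → F := fun o => o.getD 0
  -- the colour of an edge of a line outside the arc; `0` marks the free edge
  let B : ∀ l : {l : L // l ∉ Set.range A}, {p : P // p ∈ l.1} → {p : P // p ∈ l.1} → F :=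
    fun l x y => v (d l x) + v (d l y)
  have hBcomm : ∀ l x y, B l x y = B l y x := fun l x y => add_comm _ _
  let Color := ({x : F // x ≠ 0} × ZMod (q + 1)) ⊕ ({l : L // l ∉ Set.range A} × {x : F // x ≠ 0})
  let R : Color → P → P → Prop := fun c x y => x ≠ y ∧ match c with
    | .inl (t, a) => (∃ hx : x ∈ A t, ∃ hy : y ∈ A t, e (A t) ⟨x, hx⟩ + e (A t) ⟨y, hy⟩ = a) ∨
        ∃ p : {p : P // p ∈ A t}, a = e (A t) p + e (A t) p ∧
          ∃ hx : x ∈ (f ⟨t, p⟩).1, ∃ hy : y ∈ (f ⟨t, p⟩).1, B (f ⟨t, p⟩) ⟨x, hx⟩ ⟨y, hy⟩ = 0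
    | .inr (l, u) => ∃ hx : x ∈ l.1, ∃ hy : y ∈ l.1, B l ⟨x, hx⟩ ⟨y, hy⟩ = u
  let main : Color → L := fun c => match c with
    | .inl (t, _) => A t
    | .inr (l, _) => l.1
  have hline : ∀ {x y : P} {l l' : L}, x ≠ y → x ∈ l → y ∈ l → x ∈ l' → y ∈ l' → l = l' :=
    fun hxy h1 h2 h3 h4 => (Nondegenerate.eq_or_eq h1 h2 h3 h4).resolve_left hxy
  have hcover : ∀ c p, p ∈ main c → ∃ x, R c p x := by
    rintro (⟨t, a⟩ | ⟨l, u, hu⟩) p (hp : p ∈ _)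
    -- In this case the partner of `p` on `A t` would be `p` itself, so the free edge is used.
    · by_cases h : a = e (A t) ⟨p, hp⟩ + e (A t) ⟨p, hp⟩
      · have h1 := hd (f ⟨t, p, hp⟩) ⟨t, p, hp⟩ rfl
        obtain ⟨y, hy⟩ := (d (f ⟨t, p, hp⟩)).surjective (some 0)
        refine ⟨y, ?_, Or.inr ⟨⟨p, hp⟩, h, hfmem ⟨t, p, hp⟩, y.2, ?_⟩⟩
        · intro hpy
          have : (⟨p, hfmem ⟨t, p, hp⟩⟩ : {r : P // r ∈ (f ⟨t, p, hp⟩).1}) = y := Subtype.ext hpy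
          rw [this, hy] at h1
          simp at h1
        · simp only [B, v, h1]
          simp [hy]
      · obtain ⟨y, hy⟩ := (e (A t)).surjective (a - e (A t) ⟨p, hp⟩)
        refine ⟨y, ?_, Or.inl ⟨hp, y.2, by simp [hy]⟩⟩
        intro hpy
        have : (⟨p, hp⟩ : {r : P // r ∈ A t}) = y := Subtype.ext hpy
        rw [← this, eq_sub_iff_add_eq] at hy
        exact h hy.symm
    · obtain ⟨y, hy⟩ := (d l).surjective (some (v (d l ⟨p, hp⟩) + u))
      have hB : B l ⟨p, hp⟩ y = u := by
        simp only [B, hy]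
        simp only [v, Option.getD_some]
        rw [← add_assoc, hF, zero_add]
      refine ⟨y, ?_, hp, y.2, hB⟩
      rintro rfl
      exact hu (hB.symm.trans (hF _))
  have key := card_le_pseudoachromaticIndex (V := P) (C := Color)
    (n := q ^ 2 + q + 1) (by rw [hcard]; exact ProjectivePlane.card_points P L) R ?_
    (fun c x y h => h.1) ?_ ?_
  · have hC : Fintype.card Color = (q - 1) * (q + 1) + (q ^ 2 + 2) * (q - 1) := by
      have h1 : Fintype.card {l : L // l ∈ Set.range A} = q - 1 := by
        have := Fintype.card_congr (Equiv.ofInjective A hA)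
        have h' : Fintype.card {l : L // l ∈ Set.range A} = Fintype.card {x : F // x ≠ 0} := by
          convert this.symm
        omega
      have h2 := Fintype.card_subtype_compl (fun l : L => l ∈ Set.range A)
      have h3 : Fintype.card L = q ^ 2 + q + 1 := by
        rw [hcard]; exact ProjectivePlane.card_lines P L
      rw [Fintype.card_sum, Fintype.card_prod, Fintype.card_prod, ZMod.card, h2, h1, h3]
      have : Fintype.card {x : F // x ≠ 0} = q - 1 := by omega
      rw [this]
      congr 2
      omega
    rw [hC] at key
    obtain ⟨r, hr⟩ : ∃ r, q = r + 1 := ⟨q - 1, by omega⟩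
    rw [hr] at key ⊢
    simp only [Nat.add_sub_cancel] at key
    nlinarith
  · rintro (⟨t, a⟩ | ⟨l, u⟩) x y ⟨hne, h⟩
    · refine ⟨hne.symm, ?_⟩
      rcases h with ⟨hx, hy, h⟩ | ⟨p, ha, hx, hy, h⟩
      · exact Or.inl ⟨hy, hx, (add_comm _ _).trans h⟩
      · exact Or.inr ⟨p, ha, hy, hx, (hBcomm _ _ _).trans h⟩
    · obtain ⟨hx, hy, h⟩ := h
      exact ⟨hne.symm, hy, hx, (hBcomm _ _ _).trans h⟩
  · rintro (⟨t, a⟩ | ⟨l, u⟩) (⟨t', a'⟩ | ⟨l', u'⟩) x y ⟨hne, h⟩ ⟨-, h'⟩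
    · rcases h with ⟨hx, hy, h⟩ | ⟨p, ha, hx, hy, h⟩ <;>
        rcases h' with ⟨hx', hy', h'⟩ | ⟨p', ha', hx', hy', h'⟩
      · obtain rfl := hA (hline hne hx hy hx' hy')
        rw [← h, ← h']
      · exact absurd ⟨t, hline hne hx hy hx' hy'⟩ (f ⟨t', p'⟩).2
      · exact absurd ⟨t', hline hne hx' hy' hx hy⟩ (f ⟨t, p⟩).2
      · have := hf (Subtype.ext (hline hne hx hy hx' hy'))
        cases this
        rw [ha, ha']
    · obtain ⟨hx', hy', h'⟩ := h'
      rcases h with ⟨hx, hy, h⟩ | ⟨p, ha, hx, hy, h⟩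
      · exact absurd ⟨t, hline hne hx hy hx' hy'⟩ l'.2
      · obtain rfl := Subtype.ext (hline hne hx hy hx' hy')
        exact absurd (h'.symm.trans h) u'.2
    · obtain ⟨hx, hy, h⟩ := h
      rcases h' with ⟨hx', hy', h'⟩ | ⟨p, ha, hx', hy', h'⟩
      · exact absurd ⟨t', hline hne hx' hy' hx hy⟩ l.2
      · obtain rfl := Subtype.ext (hline hne hx hy hx' hy')
        exact absurd (h.symm.trans h') u.2
    · obtain ⟨hx, hy, h⟩ := h
      obtain ⟨hx', hy', h'⟩ := h'
      obtain rfl := Subtype.ext (hline hne hx hy hx' hy')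
      rw [Subtype.ext (h.symm.trans h')]
  · intro c c' _
    obtain ⟨p, hp, hp'⟩ : ∃ p, p ∈ main c ∧ p ∈ main c' := by
      by_cases h : main c = main c'
      · have : 0 < Fintype.card {p : P // p ∈ main c} := by rw [hpts]; omega
        obtain ⟨p⟩ := Fintype.card_pos_iff.1 this
        exact ⟨p, p.2, h ▸ p.2⟩
      · exact ⟨_, HasPoints.mkPoint_ax h⟩
    obtain ⟨x, hx⟩ := hcover c p hp
    obtain ⟨y, hy⟩ := hcover c' p hp'
    exact ⟨p, x, y, hx, hy⟩

open Configuration Configuration.ofField in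
open scoped LinearAlgebra.Projectivization in
/-- The lines `x + t y + t² z = 0` of `PG(2, K)` are distinct, and no three are concurrent. -/
theorem exists_dual_arc (K : Type*) [Field K] : ∃ A : K → ℙ K (Fin 3 → K),
    Function.Injective A ∧ ∀ (p : ℙ K (Fin 3 → K)) (s : Finset K), (∀ t ∈ s, p ∈ A t) →
      s.card ≤ 2 := by
  have h0 : ∀ t : K, ![1, t, t ^ 2] ≠ 0 := fun t h => one_ne_zero (congrFun h 0)
  refine ⟨fun t => Projectivization.mk K ![1, t, t ^ 2] (h0 t), fun t t' h => ?_, fun p s hs => ?_⟩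
  · obtain ⟨a, ha⟩ := (Projectivization.mk_eq_mk_iff' K _ _ _ _).1 h
    have h1 := congrFun ha 0
    have h2 := congrFun ha 1
    simp at h1 h2
    simpa [h1] using h2.symm
  · induction p with | h p hp =>
    simp only [mem_iff, Projectivization.orthogonal_mk, Matrix.dotProduct_cons] at hs
    -- Lines of the family through `p` correspond to roots of this nonzero polynomial of degree at
    -- most 2.
    let g : Polynomial K := .C (p 2) * .X ^ 2 + .C (p 1) * .X + .C (p 0)
    have hg : g ≠ 0 := by
      intro h
      apply hp
      have h0 := congrArg (Polynomial.coeff · 0) h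
      have h1 := congrArg (Polynomial.coeff · 1) h
      have h2 := congrArg (Polynomial.coeff · 2) h
      simp [g, Polynomial.coeff_X, Polynomial.coeff_C] at h0 h1 h2
      ext i
      fin_cases i <;> simp [h0, h1, h2]
    refine (Polynomial.card_le_degree_of_subset_roots (p := g) fun t ht => ?_).trans
      Polynomial.natDegree_quadratic_le
    rw [Polynomial.mem_roots hg, Polynomial.IsRoot.def]
    have := hs t ht
    simp [dotProduct, Matrix.vecHead, Matrix.vecTail] at this
    simp only [g, Polynomial.eval_add, Polynomial.eval_mul, Polynomial.eval_pow,
      Polynomial.eval_C, Polynomial.eval_X]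
    linear_combination this

open Configuration in
open scoped LinearAlgebra.Projectivization in
theorem theorem5 (q n : ℕ) (hq : ∃ m : ℕ, q = 2 ^ m) (hn : n = q ^ 2 + q + 1) :
    (q : ℤ) ^ 3 + 2 * (q : ℤ) - 3 ≤
      (pseudoachromaticIndex (SimpleGraph.completeGraph (Fin n)) : ℤ) := by
  classical
  obtain ⟨m, rfl⟩ := hq
  -- For `q = 1` there is no field of order `q`, but the bound is 0.
  rcases Nat.eq_zero_or_pos m with rfl | hm
  · simp
  let K := GaloisField 2 m
  have : Fintype K := Fintype.ofFinite K
  have hK : Fintype.card K = 2 ^ m := by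
    rw [← Nat.card_eq_fintype_card]; exact GaloisField.card 2 m hm.ne'
  have : Finite (ℙ K (Fin 3 → K)) := inferInstance
  have : Fintype (ℙ K (Fin 3 → K)) := Fintype.ofFinite _
  have horder : Fintype.card K = ProjectivePlane.order (ℙ K (Fin 3 → K)) (ℙ K (Fin 3 → K)) := by
    have h1 := ProjectivePlane.card_points (ℙ K (Fin 3 → K)) (ℙ K (Fin 3 → K))
    have h2 := Projectivization.card_of_finrank K (Fin 3 → K) (n := 3) (by simp)
    rw [Nat.card_eq_fintype_card, h1, Nat.card_eq_fintype_card] at h2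
    simp only [Finset.sum_range_succ, Finset.sum_range_zero] at h2
    nlinarith
  obtain ⟨A, hA, harc⟩ := exists_dual_arc K
  have key := le_pseudoachromaticIndex_of_projectivePlane (F := K) (fun x => CharTwo.add_self_eq_zero x)
    horder (fun t => A t) (hA.comp Subtype.val_injective) (fun p s hs => by
      rw [← Finset.card_map (Function.Embedding.subtype _)]
      refine harc p _ fun t ht => ?_
      obtain ⟨u, hu, rfl⟩ := Finset.mem_map.1 ht
      exact hs u hu)
  rw [hK] at key
  subst hn
  zify at key
  push_cast at key ⊢
  linarith
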